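/- For $d\ge 1$, $y\in\mathbb{R}^d$ and $l\in\{0,1,\dots,d\}$ let $\|y\|_{(l)}=\max_{K\subset\{1,\dots,d\},\,|K|\le l}\big(\sum_{i\in K}y_i^2\big)^{1/2}$ be the $2$-$l$-symmetric gauge norm (so $\|\cdot\|_{(0)}=0$), and let $\mathcal{L}_0:\mathbb{R}^d\to[-\infty,+\infty]$ be the Fenchel conjugate of $y\mapsto\max_{l=0,1,\dots,d}\big(\|y\|_{(l)}-l\big)$, that is, $$\mathcal{L}_0(x)=\sup_{y\in\mathbb{R}^d}\Big(\langle x,y\rangle-\max_{l=0,1,\dots,d}\big(\|y\|_{(l)}-l\big)\Big).$$ In dimension $d=2$, the function $\mathcal{L}_0$ is given by $$\mathcal{L}_0(x_1,x_2)=\begin{cases}+\infty & \text{if } x_1^2+x_2^2>1,\\ 1 & \text{if } (x_1,x_2)\in\{(1,0),(0,1),(-1,0),(0,-1)\},\\ 2 & \text{if } x_1^2+x_2^2=1 \text{ and } (x_1,x_2)\notin\{(1,0),(0,1),(-1,0),(0,-1)\},\end{cases}$$ and, for any $(x_1,x_2)$ such that $x_1^2+x_2^2<1$, by $$\mathcal{L}_0(x_1,x_2)=\begin{cases}|x_1|+|x_2|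 & \text{if } |x_1|+|x_2|\le 1,\\[1mm] \dfrac{|x_1|+|x_2|-2+\sqrt2}{\sqrt2-1} & \text{if } (\sqrt2-1)|x_1|+|x_2|<1,\ |x_1|+(\sqrt2-1)|x_2|<1 \text{ and } |x_1|+|x_2|>1,\\[2mm] \dfrac{3-|x_2|}{2}+\dfrac{x_1^2}{2(1-|x_2|)} & \text{if } (\sqrt2-1)|x_1|+|x_2|\ge 1 \text{ and } |x_2|>|x_1|,\\[2mm] \dfrac{3-|x_1|}{2}+\dfrac{x_2^2}{2(1-|x_1|)} & \text{if } |x_1|+(\sqrt2-1)|x_2|\ge 1 \text{ and } |x_1|>|x_2|.\end{cases}$$ -/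

import Mathlib

/-- The vector `x_K` that coincides with `x` on the components in `K` and vanishes on the
components outside of `K`. -/
noncomputable def restrictTo {d : ℕ} (K : Finset (Fin d)) (x : EuclideanSpace ℝ (Fin d)) :
    EuclideanSpace ℝ (Fin d) :=
  WithLp.toLp 2 (fun i => if i ∈ K then x i else 0)

/-- The `2`-`k`-symmetric gauge norm (Ky Fan vector norm): the supremum of the Euclidean norms
`‖x_K‖` over all sets `K` of at most `k` indices. It vanishes for `k = 0`. -/
noncomputable def symmetricGaugeNorm {d : ℕ} (k : ℕ) (x : EuclideanSpace ℝ (Fin d)) : ℝ :=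
  ⨆ K : {K : Finset (Fin d) // K.card ≤ k}, ‖restrictTo K.1 x‖

/-- The Fenchel conjugate `x ↦ sup_y (⟨x, y⟩ + (- g y))` of an extended real valued function.
The addition of `EReal` is the lower addition: `⊤ + ⊥ = ⊥ + ⊤ = ⊥`. -/
noncomputable def fenchelConjugate {d : ℕ} (g : EuclideanSpace ℝ (Fin d) → EReal)
    (x : EuclideanSpace ℝ (Fin d)) : EReal :=
  ⨆ y : EuclideanSpace ℝ (Fin d), ((inner ℝ x y : ℝ) : EReal) + (- g y)

/-- The function `𝓛₀` on `ℝ^d`: the Fenchel conjugate of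
`y ↦ sup_{l = 0, 1, …, d} (symmetricGaugeNorm l y - l)`. -/
noncomputable def calL0 (d : ℕ) : EuclideanSpace ℝ (Fin d) → EReal :=
  fenchelConjugate fun y =>
    ⨆ l : Fin (d + 1), ((symmetricGaugeNorm (l : ℕ) y - ((l : ℕ) : ℝ) : ℝ) : EReal)

/-!
Since `⟨z, y⟩ ≤ ‖y_K‖` for a vector `z` of the unit ball with support `K`, the function `𝓛₀` is at
most the number of nonzero entries on the unit ball, and by convexity a decomposition
`x = ∑ wᵢ zᵢ` of `x` into such vectors bounds `𝓛₀ x` from above by `∑ wᵢ |supp zᵢ|`. A vector `y`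
for which all the inequalities `⟨zᵢ, y⟩ ≤ |supp zᵢ| + max_K (‖y_K‖ - |K|)` are equalities
certifies that the bound is sharp.

On the unit sphere `x` itself is the decomposition, and far points of the ray through `x` are
certificates. In the `ℓ¹` ball one decomposes into `0` and the signed basis vectors, with
certificate `(1, …, 1)` up to signs. In the plane, up to symmetry, two regions remain: the triangle
with vertices `(1, 0)`, `(0, 1)`, `(√2/2, √2/2)`, with certificate `(1 + √2, 1 + √2)`, and the
circular cap between `(0, 1)` and `(√2/2, √2/2)`. The cap is swept by the chords from `(0, 1)` to
the points `(2r, r² - 1) / (r² + 1)` with `r ≥ 1 + √2`, and `(r, (r² - 1) / 2)` is a certificate on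
the whole chord.
-/

section GeneralDimension

variable {d : ℕ}

section Restriction

variable (K : Finset (Fin d)) (x : EuclideanSpace ℝ (Fin d))

theorem norm_restrictTo : ‖restrictTo K x‖ = √(∑ i ∈ K, x i ^ 2) := by
  simp [EuclideanSpace.norm_eq, restrictTo, apply_ite, ite_pow, Finset.sum_ite_mem]

theorem norm_restrictTo_le_norm : ‖restrictTo K x‖ ≤ ‖x‖ := by
  rw [norm_restrictTo, EuclideanSpace.norm_eq]
  simp only [Real.norm_eq_abs, sq_abs]
  exact Real.sqrt_le_sqrt
    (Finset.sum_le_sum_of_subset_of_nonneg K.subset_univ fun i _ _ => sq_nonneg (x i))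

theorem norm_restrictTo_lt_norm {i : Fin d} (hiK : i ∉ K) (hi : x i ≠ 0) :
    ‖restrictTo K x‖ < ‖x‖ := by
  rw [norm_restrictTo, EuclideanSpace.norm_eq]
  simp only [Real.norm_eq_abs, sq_abs]
  refine Real.sqrt_lt_sqrt (Finset.sum_nonneg fun j _ => sq_nonneg (x j)) ?_
  exact Finset.sum_lt_sum_of_subset K.subset_univ (Finset.mem_univ i) hiK (by positivity)
    fun j _ _ => sq_nonneg (x j)

theorem restrictTo_smul (t : ℝ) : restrictTo K (t • x) = t • restrictTo K x := by
  ext i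
  simp [restrictTo]

theorem inner_restrictTo_of_support_subset (z : EuclideanSpace ℝ (Fin d))
    (hz : ∀ i, z i ≠ 0 → i ∈ K) : inner ℝ z (restrictTo K x) = inner ℝ z x := by
  simp only [PiLp.inner_apply, restrictTo]
  refine Finset.sum_congr rfl fun i _ => ?_
  by_cases hi : z i = 0
  · simp [hi]
  · simp [hz i hi]

end Restriction

/-- The function `y ↦ max_{l = 0, …, d} (‖y‖_(l) - l)` whose conjugate is `𝓛₀`, written as the
maximum of `‖y_K‖ - |K|` over all index sets `K` in order to get rid of the cardinality `l`. -/
noncomputable def penalizedGauge (y : EuclideanSpace ℝ (Fin d)) : ℝ :=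
  ⨆ K : Finset (Fin d), (‖restrictTo K y‖ - K.card)

theorem penalizedGauge_le_iff {y : EuclideanSpace ℝ (Fin d)} {c : ℝ} :
    penalizedGauge y ≤ c ↔ ∀ K : Finset (Fin d), ‖restrictTo K y‖ ≤ c + K.card := by
  simp only [penalizedGauge, ciSup_le_iff (Set.finite_range _).bddAbove, sub_le_iff_le_add]

theorem norm_restrictTo_le_penalizedGauge_add_card (K : Finset (Fin d))
    (y : EuclideanSpace ℝ (Fin d)) : ‖restrictTo K y‖ ≤ penalizedGauge y + K.card :=
  penalizedGauge_le_iff.mp le_rfl K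

theorem penalizedGauge_le_norm (y : EuclideanSpace ℝ (Fin d)) : penalizedGauge y ≤ ‖y‖ :=
  penalizedGauge_le_iff.mpr fun K =>
    (norm_restrictTo_le_norm K y).trans (le_add_of_nonneg_right K.card.cast_nonneg)

theorem iSup_symmetricGaugeNorm_sub_eq_penalizedGauge (y : EuclideanSpace ℝ (Fin d)) :
    ⨆ l : Fin (d + 1), ((symmetricGaugeNorm (l : ℕ) y - ((l : ℕ) : ℝ) : ℝ) : EReal) =
      penalizedGauge y := by
  refine le_antisymm (iSup_le fun l => EReal.coe_le_coe ?_) ?_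
  · have : Nonempty {K : Finset (Fin d) // K.card ≤ l} := ⟨⟨∅, by simp⟩⟩
    refine sub_le_iff_le_add.mpr (ciSup_le fun ⟨K, hK⟩ => ?_)
    have hK' : (K.card : ℝ) ≤ (l : ℕ) := by exact_mod_cast hK
    linarith [norm_restrictTo_le_penalizedGauge_add_card K y]
  · obtain ⟨K, hK⟩ : ∃ K : Finset (Fin d), ‖restrictTo K y‖ - K.card = penalizedGauge y :=
      exists_eq_ciSup_of_finite
    have hgauge : ‖restrictTo K y‖ ≤ symmetricGaugeNorm K.card y :=
      le_ciSup (f := fun K' : {K' : Finset (Fin d) // K'.card ≤ K.card} => ‖restrictTo K'.1 y‖)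
        (Set.finite_range _).bddAbove ⟨K, le_rfl⟩
    rw [← hK]
    exact le_iSup_of_le ⟨K.card, Nat.lt_succ_of_le (card_finset_fin_le K)⟩
      (EReal.coe_le_coe (sub_le_sub_right hgauge _))

theorem penalizedGauge_congr_abs {y z : EuclideanSpace ℝ (Fin d)} (h : ∀ i, |y i| = |z i|) :
    penalizedGauge y = penalizedGauge z := by
  simp only [penalizedGauge, norm_restrictTo, (sq_eq_sq_iff_abs_eq_abs _ _).mpr (h _)]

theorem penalizedGauge_piLpCongrLeft (σ : Equiv.Perm (Fin d)) (y : EuclideanSpace ℝ (Fin d)) :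
    penalizedGauge (LinearIsometryEquiv.piLpCongrLeft 2 ℝ ℝ σ y) = penalizedGauge y := by
  refine (Equiv.iSup_congr (Equiv.finsetCongr σ) fun K => ?_).symm
  simp [norm_restrictTo, LinearIsometryEquiv.piLpCongrLeft_apply]

theorem calL0_eq_iSup (x : EuclideanSpace ℝ (Fin d)) :
    calL0 d x = ⨆ y, ((inner ℝ x y - penalizedGauge y : ℝ) : EReal) := by
  simp only [calL0, fenchelConjugate, iSup_symmetricGaugeNorm_sub_eq_penalizedGauge,
    ← EReal.coe_neg, ← EReal.coe_add, ← sub_eq_add_neg]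

theorem calL0_le_coe_iff {x : EuclideanSpace ℝ (Fin d)} {c : ℝ} :
    calL0 d x ≤ c ↔ ∀ y, inner ℝ x y ≤ c + penalizedGauge y := by
  simp only [calL0_eq_iSup, iSup_le_iff, EReal.coe_le_coe_iff, sub_le_iff_le_add]

theorem coe_sub_le_calL0 (x : EuclideanSpace ℝ (Fin d)) {y : EuclideanSpace ℝ (Fin d)} {c : ℝ}
    (hy : penalizedGauge y ≤ c) : ((inner ℝ x y - c : ℝ) : EReal) ≤ calL0 d x := by
  rw [calL0_eq_iSup]
  exact le_iSup_of_le y (EReal.coe_le_coe (sub_le_sub_left hy _))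

theorem calL0_map_of_penalizedGauge_map
    (T : EuclideanSpace ℝ (Fin d) ≃ₗᵢ[ℝ] EuclideanSpace ℝ (Fin d))
    (hT : ∀ y, penalizedGauge (T y) = penalizedGauge y) (x : EuclideanSpace ℝ (Fin d)) :
    calL0 d (T x) = calL0 d x := by
  rw [calL0_eq_iSup, calL0_eq_iSup]
  exact (T.toEquiv.iSup_congr fun y => by simp [hT]).symm

theorem calL0_abs (x : EuclideanSpace ℝ (Fin d)) :
    calL0 d (WithLp.toLp 2 fun i => |x i|) = calL0 d x := by
  let T : EuclideanSpace ℝ (Fin d) ≃ₗᵢ[ℝ] EuclideanSpace ℝ (Fin d) :=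
    LinearIsometryEquiv.piLpCongrRight 2 fun i =>
      if 0 ≤ x i then LinearIsometryEquiv.refl ℝ ℝ else LinearIsometryEquiv.neg ℝ
  have hTx : WithLp.toLp 2 (fun i => |x i|) = T x := by
    ext i
    by_cases hi : 0 ≤ x i
    · simp [T, hi, abs_of_nonneg hi]
    · simp [T, hi, abs_of_neg (not_le.mp hi)]
  rw [hTx]
  refine calL0_map_of_penalizedGauge_map T (fun y => penalizedGauge_congr_abs fun i => ?_) x
  by_cases hi : 0 ≤ x i <;> simp [T, hi]

theorem inner_le_hammingNorm_add_penalizedGauge {z : EuclideanSpace ℝ (Fin d)} (hz : ‖z‖ ≤ 1)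
    (y : EuclideanSpace ℝ (Fin d)) : inner ℝ z y ≤ hammingNorm z.ofLp + penalizedGauge y := by
  set K : Finset (Fin d) := {i | z i ≠ 0} with hK
  calc inner ℝ z y = inner ℝ z (restrictTo K y) :=
        (inner_restrictTo_of_support_subset K y z (by simp [hK])).symm
    _ ≤ ‖z‖ * ‖restrictTo K y‖ := real_inner_le_norm _ _
    _ ≤ ‖restrictTo K y‖ := mul_le_of_le_one_left (norm_nonneg _) hz
    _ ≤ penalizedGauge y + K.card := norm_restrictTo_le_penalizedGauge_add_card K y
    _ = hammingNorm z.ofLp + penalizedGauge y := add_comm _ _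

-- Complementary slackness: one `y` attains `inner_le_hammingNorm_add_penalizedGauge` at all `z i`.
theorem calL0_sum_smul_eq {ι : Type*} [Fintype ι] {w : ι → ℝ}
    {z : ι → EuclideanSpace ℝ (Fin d)} {y : EuclideanSpace ℝ (Fin d)} {c : ℝ}
    (hw : ∀ i, 0 ≤ w i) (hw₁ : ∑ i, w i = 1) (hz : ∀ i, ‖z i‖ ≤ 1) (hy : penalizedGauge y ≤ c)
    (hzy : ∀ i, inner ℝ (z i) y = hammingNorm (z i).ofLp + c) :
    calL0 d (∑ i, w i • z i) = ((∑ i, w i * hammingNorm (z i).ofLp : ℝ) : EReal) := by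
  have split_sum (b : ℝ) : ∑ i, w i * hammingNorm (z i).ofLp + b =
      ∑ i, w i * (hammingNorm (z i).ofLp + b) := by
    simp only [mul_add, Finset.sum_add_distrib, ← Finset.sum_mul, hw₁, one_mul]
  apply le_antisymm
  · refine calL0_le_coe_iff.mpr fun y' => ?_
    simp only [sum_inner, real_inner_smul_left, split_sum]
    exact Finset.sum_le_sum fun i _ => mul_le_mul_of_nonneg_left
      (inner_le_hammingNorm_add_penalizedGauge (hz i) y') (hw i)
  · convert coe_sub_le_calL0 (∑ i, w i • z i) hy using 2
    simp only [sum_inner, real_inner_smul_left, hzy, ← split_sum, add_sub_cancel_right]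

theorem calL0_eq_top_of_one_lt_norm {x : EuclideanSpace ℝ (Fin d)} (hx : 1 < ‖x‖) :
    calL0 d x = ⊤ := by
  refine (EReal.eq_top_iff_forall_lt _).mpr fun c => not_le.mp fun hc => ?_
  have hgap : 0 < ‖x‖ * (‖x‖ - 1) := by nlinarith
  obtain ⟨n, hn⟩ := exists_lt_nsmul hgap c
  have hray := calL0_le_coe_iff.mp hc ((n : ℝ) • x)
  have hgauge := penalizedGauge_le_norm ((n : ℝ) • x)
  rw [real_inner_smul_right, real_inner_self_eq_norm_sq] at hray
  rw [norm_smul, Real.norm_natCast] at hgauge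
  rw [nsmul_eq_mul] at hn
  linarith

-- Far out on the ray through `x`, index sets missing part of the support of `x` do not contribute.
theorem exists_penalizedGauge_smul_le {x : EuclideanSpace ℝ (Fin d)} (hx : ‖x‖ = 1) :
    ∃ t : ℝ, penalizedGauge (t • x) ≤ t - hammingNorm x.ofLp := by
  have hK (K : Finset (Fin d)) :
      ∀ᶠ t : ℝ in Filter.atTop, t * ‖restrictTo K x‖ ≤ t - hammingNorm x.ofLp + K.card := by
    by_cases hsupp : ∀ i, x i ≠ 0 → i ∈ K
    · have hcard : (hammingNorm x.ofLp : ℝ) ≤ K.card := by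
        exact_mod_cast Finset.card_le_card fun i hi => hsupp i (by simpa using hi)
      filter_upwards [Filter.eventually_ge_atTop 0] with t ht
      have := mul_le_of_le_one_right ht (hx ▸ norm_restrictTo_le_norm K x)
      linarith
    · push Not at hsupp
      obtain ⟨i, hi, hiK⟩ := hsupp
      have hlt : 0 < 1 - ‖restrictTo K x‖ := sub_pos.mpr (hx ▸ norm_restrictTo_lt_norm K x hiK hi)
      filter_upwards [(Filter.tendsto_id.atTop_mul_const hlt).eventually_ge_atTop
        (hammingNorm x.ofLp : ℝ)] with t ht
      rw [id, mul_sub, mul_one] at ht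
      linarith [K.card.cast_nonneg (α := ℝ)]
  obtain ⟨t, ht, ht₀⟩ :=
    ((Filter.eventually_all.mpr hK).and (Filter.eventually_ge_atTop 0)).exists
  refine ⟨t, penalizedGauge_le_iff.mpr fun K => ?_⟩
  simpa only [restrictTo_smul, norm_smul, Real.norm_of_nonneg ht₀] using ht K

theorem calL0_of_norm_eq_one {x : EuclideanSpace ℝ (Fin d)} (hx : ‖x‖ = 1) :
    calL0 d x = hammingNorm x.ofLp := by
  rw [← EReal.coe_coe_eq_natCast]
  obtain ⟨t, ht⟩ := exists_penalizedGauge_smul_le hx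
  refine le_antisymm (calL0_le_coe_iff.mpr (inner_le_hammingNorm_add_penalizedGauge hx.le)) ?_
  convert coe_sub_le_calL0 x ht using 2
  simp [real_inner_smul_right, hx]

theorem penalizedGauge_le_zero_of_abs_le_one {y : EuclideanSpace ℝ (Fin d)}
    (hy : ∀ i, |y i| ≤ 1) : penalizedGauge y ≤ 0 := by
  refine penalizedGauge_le_iff.mpr fun K => ?_
  rw [norm_restrictTo, zero_add]
  refine Real.sqrt_le_iff.mpr ⟨K.card.cast_nonneg, ?_⟩
  calc ∑ i ∈ K, y i ^ 2 ≤ ∑ _i ∈ K, (1 : ℝ) :=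
        Finset.sum_le_sum fun i _ => (sq_le_one_iff_abs_le_one (y i)).mpr (hy i)
    _ = K.card := by simp
    _ ≤ (K.card : ℝ) ^ 2 := by exact_mod_cast Nat.le_self_pow two_ne_zero K.card

theorem hammingNorm_single {ι M : Type*} [Fintype ι] [DecidableEq ι] [Zero M] [DecidableEq M]
    (i : ι) {a : M} (ha : a ≠ 0) : hammingNorm (Pi.single i a : ι → M) = 1 := by
  simp [hammingNorm, Pi.single_apply, ha, Finset.filter_eq']

theorem calL0_of_sum_abs_le_one {x : EuclideanSpace ℝ (Fin d)} (hx : ∑ i, |x i| ≤ 1) :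
    calL0 d x = ((∑ i, |x i| : ℝ) : EReal) := by
  -- The slack `1 - ∑ |x i|` is the weight of the origin.
  let w : Option (Fin d) → ℝ := fun o => o.elim (1 - ∑ i, |x i|) fun i => |x i|
  let z : Option (Fin d) → EuclideanSpace ℝ (Fin d) :=
    fun o => o.elim 0 fun i => EuclideanSpace.single i 1
  have hsum : ∑ o, w o • z o = WithLp.toLp 2 fun i => |x i| := by
    ext j
    simp [w, z, Fintype.sum_option, Pi.single_apply]
  have hvalue : ∑ o, w o * hammingNorm (z o).ofLp = ∑ i, |x i| := by
    simp [w, z, Fintype.sum_option, hammingNorm_single]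
  rw [← calL0_abs, ← hsum, ← hvalue]
  refine calL0_sum_smul_eq (y := WithLp.toLp 2 fun _ => 1) ?_ ?_ ?_
    (penalizedGauge_le_zero_of_abs_le_one (by simp)) ?_
  · simpa [w, Option.forall] using hx
  · simp [w, Fintype.sum_option]
  · simp [z, Option.forall]
  · simp [z, Option.forall, hammingNorm_single, EuclideanSpace.inner_single_left]

end GeneralDimension

section DimensionTwo

theorem norm_pair_eq_sqrt (a b : ℝ) : ‖!₂[a, b]‖ = √(a ^ 2 + b ^ 2) := by
  simp [EuclideanSpace.norm_eq]

theorem inner_pair (a b u v : ℝ) : inner ℝ !₂[a, b] !₂[u, v] = a * u + b * v := by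
  simp [PiLp.inner_apply, mul_comm]

theorem hammingNorm_pair (a b : ℝ) :
    hammingNorm ![a, b] = (if a = 0 then 0 else 1) + (if b = 0 then 0 else 1) := by
  by_cases ha : a = 0 <;> by_cases hb : b = 0 <;> simp [hammingNorm, Finset.card_filter, ha, hb]

theorem calL0_pair_abs (x₁ x₂ : ℝ) : calL0 2 !₂[|x₁|, |x₂|] = calL0 2 !₂[x₁, x₂] := by
  rw [← calL0_abs !₂[x₁, x₂]]
  congr 1
  ext i
  fin_cases i <;> rfl

theorem calL0_pair_swap (x₁ x₂ : ℝ) : calL0 2 !₂[x₂, x₁] = calL0 2 !₂[x₁, x₂] := by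
  rw [← calL0_map_of_penalizedGauge_map _ (penalizedGauge_piLpCongrLeft (Equiv.swap 0 1))
    !₂[x₁, x₂]]
  congr 1
  ext i
  fin_cases i <;> simp [LinearIsometryEquiv.piLpCongrLeft_apply]

theorem penalizedGauge_pair_le {u v c : ℝ} (hc : 0 ≤ c) (hu : |u| ≤ c + 1) (hv : |v| ≤ c + 1)
    (huv : u ^ 2 + v ^ 2 ≤ (c + 2) ^ 2) : penalizedGauge !₂[u, v] ≤ c := by
  refine penalizedGauge_le_iff.mpr fun K => ?_
  rw [norm_restrictTo]
  obtain rfl | rfl | rfl | rfl : K = ∅ ∨ K = {0} ∨ K = {1} ∨ K = {0, 1} := by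
    revert K
    decide
  · simpa using hc
  · simpa [Real.sqrt_sq_eq_abs] using hu
  · simpa [Real.sqrt_sq_eq_abs] using hv
  · simpa using Real.sqrt_le_iff.mpr ⟨by linarith, huv⟩

theorem calL0_of_mem_triangle_barycentric {w₁ w₂ w₃ : ℝ} (h₁ : 0 ≤ w₁) (h₂ : 0 ≤ w₂)
    (h₃ : 0 ≤ w₃) (hsum : w₁ + w₂ + w₃ = 1) :
    calL0 2 !₂[w₁ + w₃ * (√2 / 2), w₂ + w₃ * (√2 / 2)] =
      ((1 + w₃ : ℝ) : EReal) := by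
  have hsqrt : √2 * √2 = (2 : ℝ) := Real.mul_self_sqrt zero_le_two
  let w : Fin 3 → ℝ := ![w₁, w₂, w₃]
  let z : Fin 3 → EuclideanSpace ℝ (Fin 2) := ![!₂[1, 0], !₂[0, 1], !₂[√2 / 2, √2 / 2]]
  have hpoint : ∑ i, w i • z i = !₂[w₁ + w₃ * (√2 / 2), w₂ + w₃ * (√2 / 2)] := by
    ext i
    fin_cases i <;> simp [w, z, Fin.sum_univ_three]
  have hvalue : ∑ i, w i * hammingNorm (z i).ofLp = 1 + w₃ := by
    calc _ = w₁ * 1 + w₂ * 1 + w₃ * 2 := by simp [w, z, Fin.sum_univ_three, hammingNorm_pair]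
      _ = 1 + w₃ := by linear_combination hsum
  have hgauge : penalizedGauge !₂[1 + √2, 1 + √2] ≤ √2 := by
    have habs : |1 + √2| ≤ √2 + 1 := by rw [abs_of_pos (by positivity), add_comm]
    exact penalizedGauge_pair_le (Real.sqrt_nonneg 2) habs habs (by linarith)
  rw [← hpoint, ← hvalue]
  refine calL0_sum_smul_eq ?_ ?_ ?_ hgauge ?_
  · simp [w, Fin.forall_fin_succ, h₁, h₂, h₃]
  · simpa [w, Fin.sum_univ_three] using hsum
  · norm_num [z, Fin.forall_fin_succ, norm_pair_eq_sqrt, div_pow]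
  · have hinner : √2 / 2 * (1 + √2) + √2 / 2 * (1 + √2) = 2 + √2 := by linear_combination hsqrt
    simp [z, Fin.forall_fin_succ, inner_pair, hammingNorm_pair, hinner]

theorem calL0_of_mem_triangle {x₁ x₂ : ℝ} (h₁ : (√2 - 1) * |x₁| + |x₂| ≤ 1)
    (h₂ : |x₁| + (√2 - 1) * |x₂| ≤ 1) (h : 1 ≤ |x₁| + |x₂|) :
    calL0 2 !₂[x₁, x₂] = (((|x₁| + |x₂| - 2 + √2) / (√2 - 1) : ℝ) : EReal) := by
  rw [← calL0_pair_abs]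
  generalize |x₁| = a at *
  generalize |x₂| = b at *
  have hsqrt : √2 ^ 2 = (2 : ℝ) := Real.sq_sqrt zero_le_two
  have hlt : 1 < √2 := Real.one_lt_sqrt_two
  let w₃ := (a + b - 1) * (√2 + 1)
  have hw₁ : a - w₃ * (√2 / 2) = (1 - (√2 - 1) * a - b) * ((√2 + 2) / 2) := by
    simp only [w₃]
    linear_combination (1 - b) / 2 * hsqrt
  have hw₂ : b - w₃ * (√2 / 2) = (1 - a - (√2 - 1) * b) * ((√2 + 2) / 2) := by
    simp only [w₃]
    linear_combination (1 - a) / 2 * hsqrt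
  convert calL0_of_mem_triangle_barycentric (w₁ := a - w₃ * (√2 / 2)) (w₂ := b - w₃ * (√2 / 2))
    (w₃ := w₃) ?_ ?_ ?_ ?_ using 2
  · simp
  · rw [div_eq_iff (by linarith)]
    simp only [w₃]
    linear_combination (1 - a - b) * hsqrt
  · rw [hw₁]
    exact mul_nonneg (by linarith) (by positivity)
  · rw [hw₂]
    exact mul_nonneg (by linarith) (by positivity)
  · exact mul_nonneg (by linarith) (by positivity)
  · simp only [w₃]
    linear_combination (1 - a - b) * hsqrt

/-- The rational parametrization of the unit circle: `circlePoint r` is its second intersection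
point with the line through `(0, 1)` and `(r, 0)`. -/
noncomputable def circlePoint (r : ℝ) : EuclideanSpace ℝ (Fin 2) :=
  !₂[2 * r / (r ^ 2 + 1), (r ^ 2 - 1) / (r ^ 2 + 1)]

theorem norm_circlePoint (r : ℝ) : ‖circlePoint r‖ = 1 := by
  rw [circlePoint, norm_pair_eq_sqrt, Real.sqrt_eq_one]
  field_simp
  ring

theorem hammingNorm_circlePoint {r : ℝ} (hr : 1 < r) : hammingNorm (circlePoint r).ofLp = 2 := by
  have hfst : 2 * r / (r ^ 2 + 1) ≠ 0 := by positivity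
  have hsnd : (r ^ 2 - 1) / (r ^ 2 + 1) ≠ 0 := (div_pos (by nlinarith) (by positivity)).ne'
  rw [circlePoint, hammingNorm_pair, if_neg hfst, if_neg hsnd]

theorem inner_circlePoint (r : ℝ) :
    inner ℝ (circlePoint r) !₂[r, (r ^ 2 - 1) / 2] = (r ^ 2 + 1) / 2 := by
  rw [circlePoint, inner_pair]
  field_simp
  ring

theorem smul_add_smul_circlePoint (r t : ℝ) :
    (1 - (r ^ 2 + 1) * t / 2) • !₂[0, 1] + ((r ^ 2 + 1) * t / 2) • circlePoint r =
      !₂[r * t, 1 - t] := by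
  have hfst : (r ^ 2 + 1) * t / 2 * (2 * r / (r ^ 2 + 1)) = r * t := by field_simp
  have hsnd : 1 - (r ^ 2 + 1) * t / 2 + (r ^ 2 + 1) * t / 2 * ((r ^ 2 - 1) / (r ^ 2 + 1)) =
      1 - t := by
    field_simp
    ring
  ext i
  fin_cases i
  · simpa [circlePoint] using hfst
  · simpa [circlePoint] using hsnd

theorem penalizedGauge_pair_le_of_two_mul_add_one_le_sq {r : ℝ} (hr₀ : 0 < r)
    (hr : 2 * r + 1 ≤ r ^ 2) : penalizedGauge !₂[r, (r ^ 2 - 1) / 2] ≤ (r ^ 2 - 3) / 2 := by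
  refine penalizedGauge_pair_le (by nlinarith) ?_ ?_ (by linarith)
  · rw [abs_of_pos hr₀]
    linarith
  · rw [abs_of_pos (by linarith)]
    linarith

theorem calL0_of_mem_chord {r t : ℝ} (hr : √2 + 1 ≤ r) (ht : 0 ≤ t) (hrt : (r ^ 2 + 1) * t ≤ 2) :
    calL0 2 !₂[r * t, 1 - t] = ((1 + (r ^ 2 + 1) * t / 2 : ℝ) : EReal) := by
  have hr₁ : 1 < r := lt_of_lt_of_le (lt_add_of_pos_left 1 (by positivity)) hr
  have hr_sq : 2 * r + 1 ≤ r ^ 2 := by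
    nlinarith [Real.sq_sqrt (zero_le_two (α := ℝ)), Real.sqrt_nonneg 2]
  set m := (r ^ 2 + 1) * t / 2 with hm
  let w : Fin 2 → ℝ := ![1 - m, m]
  let z : Fin 2 → EuclideanSpace ℝ (Fin 2) := ![!₂[0, 1], circlePoint r]
  have hm₀ : 0 ≤ m := by positivity
  have hm₁ : m ≤ 1 := by linarith
  have hpoint : ∑ i, w i • z i = !₂[r * t, 1 - t] := by
    simpa [w, z] using smul_add_smul_circlePoint r t
  have hvalue : ∑ i, w i * hammingNorm (z i).ofLp = 1 + m := by
    calc _ = (1 - m) * 1 + m * 2 := by simp [w, z, hammingNorm_pair, hammingNorm_circlePoint hr₁]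
      _ = 1 + m := by ring
  rw [← hpoint, ← hvalue]
  refine calL0_sum_smul_eq ?_ ?_ ?_
    (penalizedGauge_pair_le_of_two_mul_add_one_le_sq (by linarith) hr_sq)
    (Fin.forall_fin_two.mpr ⟨?_, ?_⟩)
  · simp [w, hm₀, hm₁]
  · simp [w]
  · simp [z, norm_pair_eq_sqrt, norm_circlePoint]
  · simp only [z, Matrix.cons_val_zero, inner_pair, hammingNorm_pair, one_ne_zero, if_true,
      if_false]
    push_cast
    ring
  · simp only [z, Matrix.cons_val_one, Matrix.cons_val_fin_one, inner_circlePoint,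
      hammingNorm_circlePoint hr₁]
    push_cast
    ring

theorem calL0_of_mem_cap {x₁ x₂ : ℝ} (hx : x₁ ^ 2 + x₂ ^ 2 < 1)
    (h : 1 ≤ (√2 - 1) * |x₁| + |x₂|) :
    calL0 2 !₂[x₁, x₂] = (((3 - |x₂|) / 2 + x₁ ^ 2 / (2 * (1 - |x₂|)) : ℝ) : EReal) := by
  have hx₂ : 0 < 1 - |x₂| := sub_pos.mpr ((sq_lt_one_iff_abs_lt_one x₂).mp (by nlinarith))
  have hsqrt : √2 ^ 2 = (2 : ℝ) := Real.sq_sqrt zero_le_two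
  rw [← calL0_pair_abs, ← sq_abs x₁]
  rw [← sq_abs x₁, ← sq_abs x₂] at hx
  generalize |x₁| = a at *
  generalize |x₂| = b at *
  convert calL0_of_mem_chord (r := a / (1 - b)) (t := 1 - b) ?_ hx₂.le ?_ using 2
  · simp [hx₂.ne']
  · field_simp
    ring
  · rw [le_div_iff₀ hx₂]
    calc (√2 + 1) * (1 - b) ≤ (√2 + 1) * ((√2 - 1) * a) :=
          mul_le_mul_of_nonneg_left (by linarith) (by positivity)
      _ = a := by linear_combination a * hsqrt
  · field_simp
    nlinarith

theorem ne_zero_and_ne_zero_of_notMem_axes {x₁ x₂ : ℝ} (h : x₁ ^ 2 + x₂ ^ 2 = 1)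
    (hne : (x₁, x₂) ∉ ({(1, 0), (0, 1), (-1, 0), (0, -1)} : Set (ℝ × ℝ))) :
    x₁ ≠ 0 ∧ x₂ ≠ 0 := by
  refine ⟨?_, ?_⟩ <;> rintro rfl
  · obtain rfl | rfl : x₂ = 1 ∨ x₂ = -1 := sq_eq_one_iff.mp (by linarith)
    all_goals simp at hne
  · obtain rfl | rfl : x₁ = 1 ∨ x₁ = -1 := sq_eq_one_iff.mp (by linarith)
    all_goals simp at hne

end DimensionTwo

theorem mainTheorem4 (x₁ x₂ : ℝ) :
    (1 < x₁ ^ 2 + x₂ ^ 2 → calL0 2 !₂[x₁, x₂] = ⊤) ∧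
    ((x₁, x₂) ∈ ({(1, 0), (0, 1), (-1, 0), (0, -1)} : Set (ℝ × ℝ)) →
      calL0 2 !₂[x₁, x₂] = 1) ∧
    (x₁ ^ 2 + x₂ ^ 2 = 1 →
      (x₁, x₂) ∉ ({(1, 0), (0, 1), (-1, 0), (0, -1)} : Set (ℝ × ℝ)) →
      calL0 2 !₂[x₁, x₂] = 2) ∧
    (x₁ ^ 2 + x₂ ^ 2 < 1 →
      (|x₁| + |x₂| ≤ 1 →
        calL0 2 !₂[x₁, x₂] = ((|x₁| + |x₂| : ℝ) : EReal)) ∧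
      ((√2 - 1) * |x₁| + |x₂| < 1 → |x₁| + (√2 - 1) * |x₂| < 1 → 1 < |x₁| + |x₂| →
        calL0 2 !₂[x₁, x₂] = (((|x₁| + |x₂| - 2 + √2) / (√2 - 1) : ℝ) : EReal)) ∧
      (1 ≤ (√2 - 1) * |x₁| + |x₂| → |x₁| < |x₂| →
        calL0 2 !₂[x₁, x₂] = (((3 - |x₂|) / 2 + x₁ ^ 2 / (2 * (1 - |x₂|)) : ℝ) : EReal)) ∧
      (1 ≤ |x₁| + (√2 - 1) * |x₂| → |x₂| < |x₁| →
        calL0 2 !₂[x₁, x₂] = (((3 - |x₁|) / 2 + x₂ ^ 2 / (2 * (1 - |x₁|)) : ℝ) : EReal))) := by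
  refine ⟨fun h => ?_, fun h => ?_, fun h hne => ?_, fun h => ⟨fun hsum => ?_,
    fun h₁ h₂ hsum => calL0_of_mem_triangle h₁.le h₂.le hsum.le,
    fun hcap _ => calL0_of_mem_cap h hcap, fun hcap _ => ?_⟩⟩
  · refine calL0_eq_top_of_one_lt_norm ?_
    rwa [norm_pair_eq_sqrt, Real.lt_sqrt zero_le_one, one_pow]
  · simp only [Set.mem_insert_iff, Set.mem_singleton_iff, Prod.mk.injEq] at h
    rcases h with ⟨rfl, rfl⟩ | ⟨rfl, rfl⟩ | ⟨rfl, rfl⟩ | ⟨rfl, rfl⟩ <;>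
      rw [calL0_of_norm_eq_one (by simp [norm_pair_eq_sqrt])] <;> simp [hammingNorm_pair]
  · obtain ⟨hx₁, hx₂⟩ := ne_zero_and_ne_zero_of_notMem_axes h hne
    rw [calL0_of_norm_eq_one (by simp [norm_pair_eq_sqrt, h])]
    simp [hammingNorm_pair, hx₁, hx₂]
  · simpa using calL0_of_sum_abs_le_one (x := !₂[x₁, x₂]) (by simpa using hsum)
  · rw [← calL0_pair_swap]
    exact calL0_of_mem_cap (by linarith) (by linarith)
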